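/- Write each permutation $\pi$ of $[n]=\{1,\dots,n\}$ in standard cycle form: every cycle (fixed points included) is written as $(c_1c_2\cdots c_k)$ with $\pi(c_t)=c_{t+1}$ for $t<k$, starting with its smallest element $c_1$, and the cycles are listed in decreasing order of their smallest elements. Let $\mathrm{asc}(\pi)$ (resp. $\mathrm{des}(\pi)$) be the number of pairs $(c_t,c_{t+1})$, $1\le t<k$, of letters adjacent inside a cycle $(c_1\cdots c_k)$ of this form with $c_t<c_{t+1}$ (resp. $c_t>c_{t+1}$), let $\mathrm{cyc}(\pi)$ be the number of cycles and $|\pi|=n$. The weight of $\pi$ is $p^{\mathrm{des}(\pi)}q^{\mathrm{asc}(\pi)}x^{\mathrm{cyc}(\pi)}$. (1) As formal power series in $z$, with the sum over all permutations of all $[n]$, $n\ge 0$, $$\sum_{\pi}p^{\mathrm{des}(\pi)}q^{\mathrm{asc}(\pi)}x^{\mathrm{cyc}(\pi)}z^{|\pi|} =\cfrac{1}{1-xz-\cfrac{qxz^2}{1-(q+p+x)z-\cfrac{2q(p+x)z^2}{1-(2q+2p+x)z-\cfrac{3q(2p+x)z^2}{1-(3q+3p+x)z-\cdots}}}}$$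 that is, the Jacobi continued fraction with $1-(hq+hp+x)z$ at level $h\ge 0$ and numerators $hq((h-1)p+x)z^2$, $h\ge1$, converges $z$-adically to the series on the left. (2) The arc diagram of $\pi$ has nodes $1,\dots,n$ on a line and an arc from $c_t$ to $c_{t+1}$ for each adjacent pair as above. The left shape of a node is the set of its connections with nodes to its left: it contains $\rightarrow$ if an arc comes in from the left, and $\leftarrow$ if an arc goes out to the left. The right shape contains $\rightarrow$ if an arc goes out to the right, and $\leftarrow$ if an arc comes in from the right. Write $\rightleftharpoons$ for a shape containing both arrows. To the pairs (left shape, right shape) assign steps by $(\emptyset,\rightarrow),(\emptyset,\rightleftharpoons)\mapsto \mathrm N$; $(\rightarrow,\emptyset),(\rightleftharpoons,\emptyset)\mapsto \mathrm S$; $(\emptyset,\emptyset),(\rightarrow,\rightarrow)\mapsto \mathrm E$; $(\emptyset,\leftarrow),(\leftarrow,\leftarrow)\mapsto \mathrm F$. A bicoloured Motzkin path of length $n$ is a lattice path from $(0,0)$ to $(n,0)$ that never goes below height $0$, with steps $\mathrm N=(1,1)$, $\mathrm S=(1,-1)$ and two colours $\mathrm E,\mathrm F$ of the step $(1,0)$;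 its weight is the product of the weights of its steps, where a step starting at height $h$ has weight $$N_h=(h+1)q,\quad S_h=(h-1)p+x,\quad E_h=hq+x,\quad F_h=hp .$$ Then for every $n\ge0$ no other pair of shapes occurs in the arc diagram of a permutation of $[n]$, and reading off the steps at nodes $1,\dots,n$ gives a bicoloured Motzkin path $\Theta(\pi)$ without $\mathrm F$ steps at height $0$. Call two permutations of $[n]$ equivalent if they give the same path. The map $\Phi$ sending the equivalence class of $\pi$ to $\Theta(\pi)$ is a bijection from the set of equivalence classes of permutations of $[n]$ onto the set of bicoloured Motzkin paths of length $n$ without $\mathrm F$ steps at height $0$, and the sum of the weights of the permutations in a class $\mathbf E$ is the weight of the path $\Phi(\mathbf E)$. -/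

import Mathlib

namespace CyclePatterns

/-! ### Standard cycle form and cyclic ascents and descents -/

/-- The cycle of `π` through `a`, written as the word `a, π a, π (π a), …`, each element once. -/
noncomputable def cycleWord {n : ℕ} (π : Equiv.Perm (Fin n)) (a : Fin n) : List (Fin n) :=
  (List.range (Function.minimalPeriod π a)).map fun t => π^[t] a

/-- `a` is the smallest element of its cycle. -/
def IsCycleMin {n : ℕ} (π : Equiv.Perm (Fin n)) (a : Fin n) : Prop :=
  ∀ b : Fin n, π.SameCycle a b → a ≤ b

open Classical in
/-- The standard cycle form: every cycle (fixed points included) is written starting with its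
smallest element, and the cycles are listed by decreasing smallest element. -/
noncomputable def standardCycleForm {n : ℕ} (π : Equiv.Perm (Fin n)) : List (List (Fin n)) :=
  ((List.finRange n).reverse.filter fun a => IsCycleMin π a).map (cycleWord π)

/-- The pairs `(c_t, c_{t+1})` of letters that are adjacent inside a cycle `(c_1 ⋯ c_k)` of the
standard cycle form, `1 ≤ t < k`. These are also the arcs of the arc diagram of `π`. -/
noncomputable def arcs {n : ℕ} (π : Equiv.Perm (Fin n)) : List (Fin n × Fin n) :=
  (standardCycleForm π).flatMap fun c => c.zip c.tail

/-- The number of cycles. -/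
noncomputable def cyc {n : ℕ} (π : Equiv.Perm (Fin n)) : ℕ :=
  (standardCycleForm π).length

/-- The number of cyclic occurrences of the consecutive pattern `12`. -/
noncomputable def asc {n : ℕ} (π : Equiv.Perm (Fin n)) : ℕ :=
  (arcs π).countP fun e => e.1 < e.2

/-- The number of cyclic occurrences of the consecutive pattern `21`. -/
noncomputable def des {n : ℕ} (π : Equiv.Perm (Fin n)) : ℕ :=
  (arcs π).countP fun e => e.2 < e.1

/-- The weight `p ^ des q ^ asc x ^ cyc` of a permutation. -/
noncomputable def permWeight {R : Type*} [CommRing R] (p q x : R) {n : ℕ}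
    (π : Equiv.Perm (Fin n)) : R :=
  p ^ des π * q ^ asc π * x ^ cyc π

/-- The generating function `∑_π p ^ des q ^ asc x ^ cyc z ^ |π|` over all permutations of all
lengths `n ≥ 0`, as a formal power series in `z`. -/
noncomputable def genFun {R : Type*} [CommRing R] (p q x : R) : PowerSeries R :=
  PowerSeries.mk fun n => ∑ π : Equiv.Perm (Fin n), permWeight p q x π

/-! ### Jacobi continued fractions -/

/-- The finite continued fraction with `m` levels, beginning with level `h`:
`1 / (1 - b_h z - c_{h+1} z² / (1 - b_{h+1} z - ⋯ / (1 - b_{h+m-1} z)))`.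
All denominators have constant term `1`, so that they are invertible as power series. -/
noncomputable def jConvergent {R : Type*} [CommRing R] (b c : ℕ → R) : ℕ → ℕ → PowerSeries R
  | 0, _ => 0
  | m + 1, h => PowerSeries.invOfUnit
      (1 - PowerSeries.C (b h) * PowerSeries.X
        - PowerSeries.C (c (h + 1)) * PowerSeries.X ^ 2 * jConvergent b c m (h + 1)) 1

/-- The convergents are the quotients that they are meant to be. -/
theorem jConvergent_succ_mul {R : Type*} [CommRing R] (b c : ℕ → R) (m h : ℕ) :
    (1 - PowerSeries.C (b h) * PowerSeries.X
        - PowerSeries.C (c (h + 1)) * PowerSeries.X ^ 2 * jConvergent b c m (h + 1))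
      * jConvergent b c (m + 1) h = 1 := by
  rw [jConvergent]
  exact PowerSeries.mul_invOfUnit _ 1 (by simp)

/-- `F = 1 / (1 - b_0 z - c_1 z² / (1 - b_1 z - c_2 z² / (1 - b_2 z - ⋯)))`: the convergents of
the continued fraction converge to `F` in the `z`-adic topology, i.e. every coefficient of the
convergents is eventually equal to the one of `F`. -/
def HasJFraction {R : Type*} [CommRing R] (F : PowerSeries R) (b c : ℕ → R) : Prop :=
  ∀ n : ℕ, ∀ᶠ m : ℕ in Filter.atTop,
    PowerSeries.coeff n (jConvergent b c m 0) = PowerSeries.coeff n F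

/-! ### Bicoloured Motzkin paths -/

/-- North, south, and the two colours of east steps. -/
inductive Step
  | N
  | S
  | E
  | F

/-- The change of height along a step. -/
def Step.rise : Step → ℤ
  | .N => 1
  | .S => -1
  | .E => 0
  | .F => 0

/-- The height after the first `k` steps of a word of steps. -/
def height {n : ℕ} (s : Fin n → Step) (k : ℕ) : ℤ :=
  ∑ i : Fin n with i.val < k, (s i).rise

/-- Bicoloured Motzkin paths of length `n`. -/
structure MotzkinPath (n : ℕ) where
  step : Fin n → Step
  height_nonneg : ∀ k ≤ n, 0 ≤ height step k
  height_end : height step n = 0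

/-- No `F` step starts at height `0`. -/
def MotzkinPath.NoFAtZero {n : ℕ} (γ : MotzkinPath n) : Prop :=
  ∀ k : Fin n, γ.step k = .F → height γ.step k ≠ 0

/-- The weights `N_h = (h+1) q`, `S_h = (h-1) p + x`, `E_h = h q + x`, `F_h = h p` of the steps
that start at height `h`. -/
def stepWeight {R : Type*} [CommRing R] (p q x : R) (h : ℤ) : Step → R
  | .N => ((h : R) + 1) * q
  | .S => ((h : R) - 1) * p + x
  | .E => (h : R) * q + x
  | .F => (h : R) * p

/-- The weight of a path: the product of the weights of its steps. -/
def MotzkinPath.weight {R : Type*} [CommRing R] (p q x : R) {n : ℕ} (γ : MotzkinPath n) : R :=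
  ∏ k : Fin n, stepWeight p q x (height γ.step k) (γ.step k)

/-! ### Arc diagrams -/

/-- The shapes `∅`, `→`, `←`, `⇌` on one side of a node. -/
inductive Shape
  | empty
  | right
  | left
  | both

open Classical in
/-- The shape with a right-pointing arrow iff `r` and a left-pointing arrow iff `l`. -/
noncomputable def Shape.mk (r l : Prop) : Shape :=
  if r then (if l then .both else .right) else (if l then .left else .empty)

/-- The connections of node `k` with nodes to its left: a right-pointing arrow is an arc coming
in from the left, a left-pointing one is an arc going out to the left. -/
noncomputable def leftShape {n : ℕ} (π : Equiv.Perm (Fin n)) (k : Fin n) : Shape :=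
  Shape.mk (∃ a, a < k ∧ (a, k) ∈ arcs π) (∃ a, a < k ∧ (k, a) ∈ arcs π)

/-- The connections of node `k` with nodes to its right: a right-pointing arrow is an arc going
out to the right, a left-pointing one is an arc coming in from the right. -/
noncomputable def rightShape {n : ℕ} (π : Equiv.Perm (Fin n)) (k : Fin n) : Shape :=
  Shape.mk (∃ a, k < a ∧ (k, a) ∈ arcs π) (∃ a, k < a ∧ (a, k) ∈ arcs π)

/-- The step that belongs to a pair (left shape, right shape); `none` for the other pairs. -/
def stepOfShapes : Shape → Shape → Option Step
  | .empty, .empty => some .E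
  | .empty, .right => some .N
  | .empty, .left => some .F
  | .empty, .both => some .N
  | .right, .empty => some .S
  | .right, .right => some .E
  | .left, .left => some .F
  | .both, .empty => some .S
  | _, _ => none

/-- The word of steps that is read off the arc diagram of `π`. -/
noncomputable def theta {n : ℕ} (π : Equiv.Perm (Fin n)) (k : Fin n) : Option Step :=
  stepOfShapes (leftShape π k) (rightShape π k)

/-- Two permutations are equivalent if they have the same word of steps. -/
noncomputable def thetaSetoid (n : ℕ) : Setoid (Equiv.Perm (Fin n)) :=
  Setoid.ker theta

open Classical in
/-- The sum of the weights of the permutations in an equivalence class. -/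
noncomputable def classWeight {R : Type*} [CommRing R] (p q x : R) {n : ℕ}
    (C : Quotient (thetaSetoid n)) : R :=
  ∑ π : Equiv.Perm (Fin n) with Quotient.mk (thetaSetoid n) π = C, permWeight p q x π

end CyclePatterns

/-! The arc diagram omits the arc that closes each cycle, but the table of shapes is blind to this:
the step at a node records only whether the node is a cyclic valley (N), a peak (S), a double rise
or fixed point (E), or a double fall (F). So a class consists of all permutations with prescribed
local shapes (`theta_eq_iff`). The weight is local too. Every cycle has one closing step and one
maximum, and both occur at non-ascents, so `des` also counts the non-ascents that do not start at a
cycle maximum. Hence the weight is a product of factors `q` (ascent), `x` (cycle maximum) and `p`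
(other) over the elements (`permWeight_eq`).

The sum over a class is found by treating the nodes from left to right. The `h` paths that are still
open are contracted to `h` valleys of common rank `0`, below all remaining nodes. A new valley joins
them at no cost. A double rise goes after one of them, a double fall before one of them, and a peak
is removed together with the valley that follows it. This gives `completionWeight_eq`, whose factor
`h! q ^ h` shifts the weight `(h + 1) q` from the S step, where the valley disappears, to the N step
of the path.

At `p = q = x = 1` in `ℤ` the class sum is the size of the class. It is nonzero exactly when the
word is an admissible path, which yields both that every permutation gives such a path and that
every path is attained. Summing over all words of steps gives the series, and splitting paths at
their first descents gives the continued fraction (`coeff_convergentFrom`). -/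

namespace CyclePatterns

open Equiv Finset

/-! ### Permutations with prescribed local shapes -/

section Classes

variable {α β : Type*}

/-- `a` is a cyclic valley, a cyclic peak, a cyclic double rise or a fixed point, or a cyclic
double fall of `π`, where elements are compared by their rank `r`. -/
def HasStep (r : α → ℕ) (π : Perm α) (a : α) : Step → Prop
  | .N => r a < r (π a) ∧ r a < r (π.symm a)
  | .S => r (π a) < r a ∧ r (π.symm a) < r a
  | .E => π a = a ∨ (r (π.symm a) < r a ∧ r a < r (π a))
  | .F => r (π a) < r a ∧ r a < r (π.symm a)

/-- Every element `a` has the local shape `s a` in `π`. -/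
def InClass (r : α → ℕ) (s : α → Step) (π : Perm α) : Prop :=
  ∀ a, HasStep r π a (s a)

theorem hasStep_congr {r : α → ℕ} {r' : β → ℕ} {π : Perm α} {σ : Perm β} {a : α} {b : β}
    (h₁ : r a < r (π a) ↔ r' b < r' (σ b)) (h₂ : r (π a) < r a ↔ r' (σ b) < r' b)
    (h₃ : r a < r (π.symm a) ↔ r' b < r' (σ.symm b)) (h₄ : r (π.symm a) < r a ↔ r' (σ.symm b) < r' b)
    (h₅ : π a = a ↔ σ b = b) (t : Step) : HasStep r π a t ↔ HasStep r' σ b t := by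
  cases t <;> simp only [HasStep, h₁, h₂, h₃, h₄, h₅]

/-- Of two valleys adjacent in a cycle, each would have to be smaller than the other. -/
theorem InClass.apply_ne_N {r : α → ℕ} {s : α → Step} {π : Perm α} (h : InClass r s π) {a : α}
    (ha : s a = .N) : s (π a) ≠ .N := by
  intro hb
  have h₁ := h a
  have h₂ := h (π a)
  rw [ha] at h₁
  rw [hb] at h₂
  have h₃ := h₂.2
  rw [Equiv.symm_apply_apply] at h₃
  exact absurd h₁.1 h₃.asymm

/-- One step of `π` may become several steps of `σ`, or none, so this covers conjugation as well as
insertion and deletion of elements. -/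
theorem sameCycle_map {π : Perm α} {σ : Perm β} (φ : α → β)
    (h : ∀ u, σ.SameCycle (φ u) (φ (π u))) {u v : α} (huv : π.SameCycle u v) :
    σ.SameCycle (φ u) (φ v) := by
  obtain ⟨n, rfl⟩ := huv
  induction n using Int.induction_on with
  | zero => exact .rfl
  | succ n ih =>
    rw [add_comm, zpow_add, zpow_one, Perm.mul_apply]
    exact ih.trans (h _)
  | pred n ih =>
    refine ih.trans (Perm.SameCycle.symm ?_)
    have := h ((π ^ (-(n : ℤ) - 1)) u)
    rwa [← Perm.mul_apply, ← zpow_one_add, show 1 + (-(n : ℤ) - 1) = -n by ring] at this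

variable {R : Type*}

open Classical in
/-- The weight of an element: `q` if it is followed by an element of larger rank, otherwise `x` if
its rank is the largest one in its cycle, and `p` if not. -/
noncomputable def nodeWeight (p q x : R) (r : α → ℕ) (π : Perm α) (a : α) : R :=
  if r a < r (π a) then q else if ∀ b, π.SameCycle a b → r b ≤ r a then x else p

/-- Elements outside the range of `g` could only spoil the test for a cycle maximum. That test is
made only where `σ` does not rise, and there `hlow` keeps them from being larger. -/
theorem nodeWeight_comp (p q x : R) {r : α → ℕ} {π : Perm α} {σ : Perm β} (g : β → α) {a : β}
    (hup : r (g a) < r (π (g a)) ↔ r (g a) < r (g (σ a)))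
    (hc : ∀ b, π.SameCycle (g a) (g b) ↔ σ.SameCycle a b)
    (hlow : ∀ c ∉ Set.range g, ¬ r (g a) < r (g (σ a)) → r c ≤ r (g a)) :
    nodeWeight p q x r π (g a) = nodeWeight p q x (r ∘ g) σ a := by
  unfold nodeWeight
  simp only [hup, Function.comp_apply]
  by_cases h : r (g a) < r (g (σ a))
  · simp only [if_pos h]
  · simp only [if_neg h]
    congr 1
    refine propext ⟨fun H b hb => H _ ((hc b).2 hb), fun H c hac => ?_⟩
    by_cases hcg : c ∈ Set.range g
    · obtain ⟨b, rfl⟩ := hcg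
      exact H b ((hc b).1 hac)
    · exact hlow c hcg h

variable [CommRing R] [Fintype α] [Fintype β]

open Classical in
/-- The product of the weights of the elements if `π` has the local shapes `s`, and `0` if not. -/
noncomputable def classTerm (p q x : R) (r : α → ℕ) (s : α → Step) (π : Perm α) : R :=
  if InClass r s π then ∏ a, nodeWeight p q x r π a else 0

theorem classTerm_comp_equiv (p q x : R) (r : α → ℕ) (s : α → Step) (e : β ≃ α) (σ : Perm β) :
    classTerm p q x (r ∘ e) (s ∘ e) σ = classTerm p q x r s (e.permCongr σ) := by
  classical
  unfold classTerm
  have hinv : ∀ a, (e.permCongr σ).symm (e a) = e (σ.symm a) := fun a => by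
    rw [Equiv.symm_apply_eq]; simp
  have h₁ : InClass (r ∘ e) (s ∘ e) σ ↔ InClass r s (e.permCongr σ) := by
    unfold InClass
    rw [← e.forall_congr_right]
    refine forall_congr' fun a => ?_
    exact hasStep_congr (by simp) (by simp) (by simp [hinv]) (by simp [hinv]) (by simp) _
  simp only [h₁]
  congr 1
  refine Fintype.prod_equiv e _ _ fun a => (nodeWeight_comp p q x e (by simp) ?_ ?_).symm
  · intro b
    constructor
    · intro h
      simpa using sameCycle_map (σ := σ) e.symm (fun u => by simp [Perm.SameCycle.rfl]) h
    · exact fun h => sameCycle_map e (fun u => ⟨1, by simp⟩) h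
  · exact fun c hc => absurd (e.surjective c) hc

variable [DecidableEq α] [DecidableEq β]

/-- The sum of the weights of all permutations with the local shapes `s`. -/
noncomputable def wordWeight (p q x : R) (r : α → ℕ) (s : α → Step) : R :=
  ∑ π : Perm α, classTerm p q x r s π

theorem wordWeight_comp_equiv (p q x : R) (r : α → ℕ) (s : α → Step) (e : β ≃ α) :
    wordWeight p q x (r ∘ e) (s ∘ e) = wordWeight p q x r s :=
  Fintype.sum_equiv e.permCongr _ _ fun σ => classTerm_comp_equiv p q x r s e σ

/-- The ranks of two valleys are never compared: valleys are not adjacent in a cycle, and maximality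
is tested only at elements that do not rise. This is what permits all open valleys to be lowered to
the same rank. -/
theorem wordWeight_congr_rank (p q x : R) {r r' : α → ℕ} {s : α → Step}
    (h : ∀ a b, s a = .N ∧ s b = .N ∨ (r a < r b ↔ r' a < r' b)) :
    wordWeight p q x r s = wordWeight p q x r' s := by
  classical
  have key : ∀ {r r' : α → ℕ}, (∀ a b, s a = .N ∧ s b = .N ∨ (r a < r b ↔ r' a < r' b)) →
      ∀ π, InClass r s π → InClass r' s π := by
    intro r r' h π hπ a
    have h₁ := h a (π a)
    have h₂ := h (π a) a
    have h₃ := h a (π.symm a)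
    have h₄ := h (π.symm a) a
    have n₁ := fun ha => hπ.apply_ne_N (a := a) ha
    have n₂ := fun ha => hπ.apply_ne_N (a := π.symm a) ha
    rw [Equiv.apply_symm_apply] at n₂
    refine (hasStep_congr ?_ ?_ ?_ ?_ Iff.rfl _).1 (hπ a) <;> tauto
  unfold wordWeight classTerm
  refine Finset.sum_congr rfl fun π _ => ?_
  have hiff : InClass r s π ↔ InClass r' s π :=
    ⟨key h π, key (fun a b => (h a b).imp_right Iff.symm) π⟩
  by_cases hπ : InClass r s π
  · rw [if_pos hπ, if_pos (hiff.1 hπ)]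
    refine Finset.prod_congr rfl fun a _ => ?_
    have hup : r a < r (π a) ↔ r' a < r' (π a) :=
      (h a (π a)).resolve_left fun hN => hπ.apply_ne_N hN.1 hN.2
    unfold nodeWeight
    simp only [← hup]
    by_cases hu : r a < r (π a)
    · simp only [if_pos hu]
    · simp only [if_neg hu]
      have ha : s a ≠ .N := fun ha => by
        have := hπ a
        rw [ha] at this
        exact hu this.1
      congr 1
      refine propext (forall_congr' fun b => imp_congr_right fun _ => ?_)
      rw [← not_lt, ← not_lt, (h a b).resolve_left fun hN => ha hN.1]
  · rw [if_neg hπ, if_neg (hiff.not.1 hπ)]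

end Classes

/-! ### Inserting an element into a cycle -/

section Insertion

variable {α : Type*}

theorem optionCongr_symm_some (σ : Perm α) (a : α) :
    (optionCongr σ).symm (some a) = some (σ.symm a) := by
  rw [Equiv.symm_apply_eq]; simp

theorem sameCycle_optionCongr {σ : Perm α} {a b : α} :
    Perm.SameCycle (optionCongr σ)  (some a) (some b) ↔ σ.SameCycle a b := by
  constructor
  · intro h
    refine sameCycle_map (π := optionCongr σ) (σ := σ) (fun u : Option α => u.getD a)
      (fun u => ?_) h
    cases u with
    | none => exact .rfl
    | some u => exact ⟨1, by simp⟩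
  · exact fun h => sameCycle_map (σ := optionCongr σ) some (fun u => ⟨1, by simp⟩) h

variable [DecidableEq α]

/-- The permutation `σ` with the new element `none` inserted after `i`. -/
def insertAfter (i : α) (σ : Perm α) : Perm (Option α) :=
  optionCongr σ * swap none (some i)

@[simp] theorem insertAfter_none (i : α) (σ : Perm α) :
    insertAfter i σ none = some (σ i) := by simp [insertAfter]

@[simp] theorem insertAfter_self (i : α) (σ : Perm α) :
    insertAfter i σ (some i) = none := by simp [insertAfter]

theorem insertAfter_of_ne {i a : α} (h : a ≠ i) (σ : Perm α) :
    insertAfter i σ (some a) = some (σ a) := by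
  simp [insertAfter, swap_apply_of_ne_of_ne, h]

@[simp] theorem insertAfter_inv_none (i : α) (σ : Perm α) :
    (insertAfter i σ).symm none = some i := by
  rw [Equiv.symm_apply_eq]; simp

@[simp] theorem insertAfter_inv_apply (i : α) (σ : Perm α) :
    (insertAfter i σ).symm (some (σ i)) = none := by
  rw [Equiv.symm_apply_eq]; simp

theorem insertAfter_inv_of_ne {i a : α} {σ : Perm α} (h : a ≠ σ i) :
    (insertAfter i σ).symm (some a) = some (σ.symm a) := by
  rw [Equiv.symm_apply_eq, insertAfter_of_ne, Equiv.apply_symm_apply]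
  rwa [Ne, Equiv.symm_apply_eq]

theorem sameCycle_insertAfter {i : α} {σ : Perm α} {a b : α} :
    (insertAfter i σ).SameCycle (some a) (some b) ↔ σ.SameCycle a b := by
  constructor
  · intro h
    refine sameCycle_map (σ := σ) (fun u : Option α => u.getD i) (fun u => ?_) h
    cases u with
    | none => exact ⟨1, by simp⟩
    | some u =>
      by_cases hu : u = i
      · subst hu; simp [Perm.SameCycle.rfl]
      · exact ⟨1, by simp [insertAfter_of_ne hu]⟩
  · intro h
    refine sameCycle_map some (fun u => ?_) h
    by_cases hu : u = i
    · subst hu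
      exact ⟨2, by rw [zpow_two, Perm.mul_apply]; simp⟩
    · exact ⟨1, by simp [insertAfter_of_ne hu]⟩

variable [Fintype α]

/-- Either the new element is fixed, or deleting it from its cycle leaves `σ` and its predecessor
`i`. -/
theorem sum_perm_option {M : Type*} [AddCommMonoid M] (f : Perm (Option α) → M) :
    ∑ π, f π = ∑ σ : Perm α, f (optionCongr σ) + ∑ σ : Perm α, ∑ i, f (insertAfter i σ) := by
  rw [← Perm.decomposeOption.symm.sum_comp, Fintype.sum_prod_type, Fintype.sum_option]
  congr 1
  · simp [← Perm.one_def]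
  · rw [Finset.sum_comm]
    refine Finset.sum_congr rfl fun σ _ => ?_
    -- `decomposeOption` is indexed by the image of `none`, here it is the predecessor `i`; the
    -- image is `σ i`.
    rw [← Equiv.sum_comp σ]
    refine Finset.sum_congr rfl fun i _ => congrArg f ?_
    ext u
    cases u with
    | none => simp
    | some u =>
      by_cases hu : u = i
      · subst hu; simp
      · simp [insertAfter_of_ne hu, swap_apply_of_ne_of_ne, hu]

end Insertion

/-! ### Removing a double rise, a fixed point or a double fall -/

section Recurrences

variable {α : Type*} {r : Option α → ℕ}

theorem hasStep_optionCongr {σ : Perm α} {a : α} {t : Step} :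
    HasStep r (optionCongr σ) (some a) t ↔ HasStep (r ∘ some) σ a t :=
  hasStep_congr (by simp) (by simp) (by simp [optionCongr_symm_some])
    (by simp [optionCongr_symm_some]) (by simp) t

variable {R : Type*} {s : Option α → Step}

/-- If all elements of smaller rank than the new one are valleys, then the other elements keep
their weights on insertion of the new one. -/
theorem nodeWeight_option (p q x : R) {π : Perm (Option α)} {σ : Perm α}
    (hN : ∀ a, r (some a) < r none → s (some a) = .N) (hσ : InClass (r ∘ some) (s ∘ some) σ)
    (hup : ∀ a, r (some a) < r (π (some a)) ↔ r (some a) < r (some (σ a)))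
    (hc : ∀ a b, π.SameCycle (some a) (some b) ↔ σ.SameCycle a b) (a : α) :
    nodeWeight p q x r π (some a) = nodeWeight p q x (r ∘ some) σ a := by
  refine nodeWeight_comp p q x some (hup a) (hc a) fun c hcs hd => ?_
  cases c with
  | some c => simp at hcs
  | none =>
    by_contra hlt
    have := hσ a
    rw [Function.comp_apply, hN a (by omega)] at this
    exact hd this.1

theorem nodeWeight_optionCongr (p q x : R) {σ : Perm α}
    (hN : ∀ a, r (some a) < r none → s (some a) = .N) (hσ : InClass (r ∘ some) (s ∘ some) σ)
    (a : α) : nodeWeight p q x r (optionCongr σ) (some a) = nodeWeight p q x (r ∘ some) σ a :=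
  nodeWeight_option p q x hN hσ (by simp) (fun _ _ => sameCycle_optionCongr) a

variable [DecidableEq α]

/-- The rank of the new element lies strictly between those of its neighbours, so each neighbour
still compares in the same way with what is next to it. -/
theorem hasStep_insertAfter {σ : Perm α} {i a : α} {t : Step}
    (h : r (some i) < r none ∧ r none < r (some (σ i)) ∨
      r (some (σ i)) < r none ∧ r none < r (some i)) :
    HasStep r (insertAfter i σ) (some a) t ↔ HasStep (r ∘ some) σ a t := by
  have hi : ∀ b, b = i → σ b ≠ b := by
    rintro b rfl hb
    rw [hb] at h
    omega
  have h₁ : insertAfter i σ (some a) = some (σ a) ∨ a = i ∧ insertAfter i σ (some a) = none := by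
    by_cases ha : a = i
    · exact .inr ⟨ha, by subst ha; simp⟩
    · exact .inl (insertAfter_of_ne ha σ)
  have h₂ : (insertAfter i σ).symm (some a) = some (σ.symm a) ∨
      a = σ i ∧ (insertAfter i σ).symm (some a) = none := by
    by_cases ha : a = σ i
    · exact .inr ⟨ha, by subst ha; simp⟩
    · exact .inl (insertAfter_inv_of_ne ha)
  have h₃ : a = σ i → σ.symm a = i := fun ha => by simp [ha]
  apply hasStep_congr
  · rcases h₁ with h₁ | ⟨rfl, h₁⟩ <;> simp only [h₁, Function.comp_apply]
    omega
  · rcases h₁ with h₁ | ⟨rfl, h₁⟩ <;> simp only [h₁, Function.comp_apply]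
    omega
  · rcases h₂ with h₂ | ⟨ha, h₂⟩ <;> simp only [h₂, Function.comp_apply]
    rw [h₃ ha, ha]
    omega
  · rcases h₂ with h₂ | ⟨ha, h₂⟩ <;> simp only [h₂, Function.comp_apply]
    rw [h₃ ha, ha]
    omega
  · rcases h₁ with h₁ | ⟨ha, h₁⟩ <;> simp only [h₁]
    · simp
    · simpa using hi a ha

theorem nodeWeight_insertAfter (p q x : R) {σ : Perm α} {i : α}
    (h : r (some i) < r none ∧ r none < r (some (σ i)) ∨
      r (some (σ i)) < r none ∧ r none < r (some i))
    (hN : ∀ a, r (some a) < r none → s (some a) = .N) (hσ : InClass (r ∘ some) (s ∘ some) σ)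
    (a : α) :
    nodeWeight p q x r (insertAfter i σ) (some a) = nodeWeight p q x (r ∘ some) σ a := by
  refine nodeWeight_option p q x hN hσ (fun b => ?_) (fun _ _ => sameCycle_insertAfter) a
  by_cases hb : b = i
  · subst hb
    rw [insertAfter_self]
    omega
  · rw [insertAfter_of_ne hb]

variable [Fintype α] [CommRing R]

/-- A fixed point contributes `x`. Otherwise the predecessor is one of the smaller elements, and any
of them will do: it is a valley, so its old successor is not one and hence lies above the new
element, which contributes `q`. -/
theorem wordWeight_option_E (p q x : R) (hr : ∀ a, r (some a) ≠ r none)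
    (hN : ∀ a, r (some a) < r none → s (some a) = .N) (hs : s none = .E) :
    wordWeight p q x r s =
      ((#{a : α | r (some a) < r none} : ℕ) * q + x) *
        wordWeight p q x (r ∘ some) (s ∘ some) := by
  classical
  unfold wordWeight classTerm
  rw [sum_perm_option, mul_sum, ← sum_add_distrib]
  refine sum_congr rfl fun σ _ => ?_
  have h₀ : InClass r s (optionCongr σ) ↔ InClass (r ∘ some) (s ∘ some) σ := by
    constructor
    · exact fun h a => hasStep_optionCongr.1 (h (some a))
    · rintro h (_ | a)
      · rw [hs]; exact .inl (by simp)
      · exact hasStep_optionCongr.2 (h a)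
  have hb : InClass (r ∘ some) (s ∘ some) σ → ∀ i, r (some i) < r none →
      r none < r (some (σ i)) := by
    intro h i hi
    have := h.apply_ne_N (hN i hi)
    have := mt (hN (σ i)) this
    have := hr (σ i)
    omega
  have h₁ : ∀ i, InClass r s (insertAfter i σ) ↔
      r (some i) < r none ∧ InClass (r ∘ some) (s ∘ some) σ := by
    intro i
    constructor
    · intro h
      have hn := h none
      rw [hs] at hn
      simp only [HasStep, insertAfter_none, reduceCtorEq, false_or, insertAfter_inv_none] at hn
      exact ⟨hn.1, fun a => (hasStep_insertAfter (.inl hn)).1 (h (some a))⟩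
    · rintro ⟨hi, h⟩ (_ | a)
      · rw [hs]
        simpa [HasStep] using ⟨hi, hb h i hi⟩
      · exact (hasStep_insertAfter (.inl ⟨hi, hb h i hi⟩)).2 (h a)
  simp only [h₀, h₁]
  by_cases hσ : InClass (r ∘ some) (s ∘ some) σ
  · have w₀ : nodeWeight p q x r (optionCongr σ) none = x := by
      unfold nodeWeight
      rw [if_neg (by simp), if_pos]
      rintro b ⟨n, hn⟩
      rw [Equiv.Perm.zpow_apply_eq_self_of_apply_eq_self (by simp)] at hn
      rw [← hn]
    have w₁ : ∀ i, r (some i) < r none → nodeWeight p q x r (insertAfter i σ) none = q := by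
      intro i hi
      unfold nodeWeight
      rw [if_pos (by simpa using hb hσ i hi)]
    have w₂ : ∀ i, (if r (some i) < r none then
        ∏ a, nodeWeight p q x r (insertAfter i σ) a else 0) =
        if r (some i) < r none then q * ∏ a, nodeWeight p q x (r ∘ some) σ a else 0 := by
      intro i
      split_ifs with hi
      · rw [Fintype.prod_option, w₁ i hi]
        congr 1
        exact prod_congr rfl fun a _ =>
          nodeWeight_insertAfter p q x (.inl ⟨hi, hb hσ i hi⟩) hN hσ a
      · rfl
    simp only [hσ, and_true, if_true, w₂]
    simp only [Fintype.prod_option, w₀,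
      nodeWeight_optionCongr p q x hN hσ]
    rw [← sum_filter, sum_const, nsmul_eq_mul]
    ring
  · simp [hσ]

/-- Mirror image of the double rise: now the successor is one of the smaller valleys. The
predecessor is larger, so the new element is no cycle maximum and contributes `p`. -/
theorem wordWeight_option_F (p q x : R) (hr : ∀ a, r (some a) ≠ r none)
    (hN : ∀ a, r (some a) < r none → s (some a) = .N) (hs : s none = .F) :
    wordWeight p q x r s =
      (#{a : α | r (some a) < r none} : ℕ) * p * wordWeight p q x (r ∘ some) (s ∘ some) := by
  classical
  unfold wordWeight classTerm
  rw [sum_perm_option, mul_sum, ← sum_add_distrib]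
  refine sum_congr rfl fun σ _ => ?_
  have h₀ : ¬ InClass r s (optionCongr σ) := fun h => by
    have := h none
    rw [hs] at this
    simp [HasStep] at this
  have hb : InClass (r ∘ some) (s ∘ some) σ → ∀ i, r (some (σ i)) < r none →
      r none < r (some i) := by
    intro h i hi
    have := mt (h.apply_ne_N (a := i)) (not_not.2 (hN _ hi))
    have := mt (hN i) this
    have := hr i
    omega
  have h₁ : ∀ i, InClass r s (insertAfter i σ) ↔
      r (some (σ i)) < r none ∧ InClass (r ∘ some) (s ∘ some) σ := by
    intro i
    constructor
    · intro h
      have hn := h none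
      rw [hs] at hn
      simp only [HasStep, insertAfter_none, insertAfter_inv_none] at hn
      exact ⟨hn.1, fun a => (hasStep_insertAfter (.inr hn)).1 (h (some a))⟩
    · rintro ⟨hi, h⟩ (_ | a)
      · rw [hs]
        simpa [HasStep] using ⟨hi, hb h i hi⟩
      · exact (hasStep_insertAfter (.inr ⟨hi, hb h i hi⟩)).2 (h a)
  simp only [h₀, h₁, if_false, zero_add]
  by_cases hσ : InClass (r ∘ some) (s ∘ some) σ
  · have w₁ : ∀ i, r (some (σ i)) < r none →
        nodeWeight p q x r (insertAfter i σ) none = p := by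
      intro i hi
      unfold nodeWeight
      rw [if_neg (by simpa using hi.le), if_neg]
      intro H
      exact absurd (hb hσ i hi) (H (some i) ⟨-1, by simp⟩).not_gt
    have w₂ : ∀ i, (if r (some (σ i)) < r none then
        ∏ a, nodeWeight p q x r (insertAfter i σ) a else 0) =
        if r (some (σ i)) < r none then p * ∏ a, nodeWeight p q x (r ∘ some) σ a else 0 := by
      intro i
      split_ifs with hi
      · rw [Fintype.prod_option, w₁ i hi]
        congr 1
        exact prod_congr rfl fun a _ =>
          nodeWeight_insertAfter p q x (.inr ⟨hi, hb hσ i hi⟩) hN hσ a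
      · rfl
    simp only [hσ, and_true, if_true, w₂]
    -- The condition concerns the successor `σ i`, so it becomes the index of summation.
    rw [Equiv.sum_comp σ fun i => if r (some i) < r none then
      p * ∏ a, nodeWeight p q x (r ∘ some) σ a else 0, ← sum_filter, sum_const, nsmul_eq_mul]
    ring
  · simp [hσ]

end Recurrences

/-! ### Removing a peak together with the valley after it -/

section Peak

variable {β : Type*} {R : Type*} {r : Option (Option β) → ℕ} {s : Option (Option β) → Step}

theorem nodeWeight_option_option (p q x : R) {π : Perm (Option (Option β))} {τ : Perm β}
    (h₁ : r (some none) < r none)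
    (hN : ∀ a, r (some (some a)) < r none → s (some (some a)) = .N)
    (hτ : InClass (r ∘ some ∘ some) (s ∘ some ∘ some) τ)
    (hup : ∀ a, r (some (some a)) < r (π (some (some a))) ↔
      r (some (some a)) < r (some (some (τ a))))
    (hc : ∀ a b, π.SameCycle (some (some a)) (some (some b)) ↔ τ.SameCycle a b) (a : β) :
    nodeWeight p q x r π (some (some a)) = nodeWeight p q x (r ∘ some ∘ some) τ a := by
  refine nodeWeight_comp p q x (some ∘ some) (hup a) (hc a) fun c hcs hd => ?_
  have : r none ≤ r (some (some a)) := by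
    by_contra hlt
    have := hτ a
    rw [Function.comp_apply, Function.comp_apply, hN a (by omega)] at this
    exact hd this.1
  rcases c with _ | _ | c
  · exact this
  · exact h₁.le.trans this
  · exact absurd ⟨c, rfl⟩ hcs

variable [DecidableEq β]

/-- Either the two new elements form a 2-cycle, or they are inserted together: `i → none → some none
→ τ i`. -/
theorem sum_perm_option_option [Fintype β] {M : Type*} [AddCommMonoid M]
    (f : Perm (Option (Option β)) → M) :
    (∑ π, if π none = some none then f π else 0) =
      ∑ τ : Perm β, f (insertAfter none (optionCongr τ)) +
        ∑ τ : Perm β, ∑ i, f (insertAfter (some i) (insertAfter i τ)) := by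
  rw [sum_perm_option]
  simp only [optionCongr_apply, Option.map_none, reduceCtorEq, if_false, sum_const_zero, zero_add,
    insertAfter_none, Option.some.injEq]
  rw [sum_perm_option]
  congr 1
  · refine sum_congr rfl fun τ _ => ?_
    simp
  · refine sum_congr rfl fun τ _ => sum_congr rfl fun i _ => ?_
    rw [Fintype.sum_option, insertAfter_none, if_neg (by simp), zero_add,
      Finset.sum_eq_single i]
    · simp
    · intro b _ hb
      rw [insertAfter_of_ne hb, if_neg (by simp)]
    · simp

/-- The arc `i → τ i` was rising. Afterwards `i` still rises, to the peak, and `τ i` is still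
entered from below, from the valley. -/
theorem hasStep_insertAfter_insertAfter {τ : Perm β} {i a : β} {t : Step}
    (h₁ : r (some (some i)) < r none) (h₂ : r (some none) < r none)
    (h₃ : r none < r (some (some (τ i)))) :
    HasStep r (insertAfter (some i) (insertAfter i τ)) (some (some a)) t ↔
      HasStep (r ∘ some ∘ some) τ a t := by
  have hi : a = i → τ a ≠ a := by
    rintro rfl hb
    rw [hb] at h₃
    omega
  set π := insertAfter (some i) (insertAfter i τ) with hπ
  have e₁ : π (some (some a)) = some (some (τ a)) ∨ a = i ∧ π (some (some a)) = none := by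
    by_cases ha : a = i
    · exact .inr ⟨ha, by subst ha; simp [hπ]⟩
    · exact .inl (by rw [hπ, insertAfter_of_ne (by simpa using ha), insertAfter_of_ne ha])
  have e₂ : π.symm (some (some a)) = some (some (τ.symm a)) ∨
      a = τ i ∧ π.symm (some (some a)) = some none := by
    by_cases ha : a = τ i
    · refine .inr ⟨ha, ?_⟩
      subst ha
      rw [hπ, insertAfter_inv_of_ne (by simp), insertAfter_inv_apply]
    · exact .inl (by rw [hπ, insertAfter_inv_of_ne (by simp), insertAfter_inv_of_ne ha])
  have e₃ : a = τ i → τ.symm a = i := fun ha => by simp [ha]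
  apply hasStep_congr
  · rcases e₁ with e₁ | ⟨rfl, e₁⟩ <;> simp only [e₁, Function.comp_apply]
    omega
  · rcases e₁ with e₁ | ⟨rfl, e₁⟩ <;> simp only [e₁, Function.comp_apply]
    omega
  · rcases e₂ with e₂ | ⟨ha, e₂⟩ <;> simp only [e₂, Function.comp_apply]
    rw [e₃ ha, ha]
    omega
  · rcases e₂ with e₂ | ⟨ha, e₂⟩ <;> simp only [e₂, Function.comp_apply]
    rw [e₃ ha, ha]
    omega
  · rcases e₁ with e₁ | ⟨ha, e₁⟩ <;> simp only [e₁]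
    · simp
    · simpa using hi ha

variable [Fintype β] [CommRing R]

/-- The permutations in which the new peak `none` is followed by the valley `some none`. -/
theorem sum_peak_option (p q x : R) (hr : ∀ a, r (some (some a)) ≠ r none)
    (h₁ : r (some none) < r none)
    (hN : ∀ a, r (some (some a)) < r none → s (some (some a)) = .N)
    (hs : s none = .S) (hs₁ : s (some none) = .N) :
    (∑ π : Perm (Option (Option β)), if π none = some none then
        classTerm p q x r s π else 0) =
      ((#{a : β | r (some (some a)) < r none} : ℕ) * p + x) * q *
        wordWeight p q x (r ∘ some ∘ some) (s ∘ some ∘ some) := by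
  classical
  rw [sum_perm_option_option, ← sum_add_distrib]
  unfold wordWeight classTerm
  rw [mul_sum]
  refine sum_congr rfl fun τ _ => ?_
  have i₀ : InClass r s (insertAfter none (optionCongr τ)) ↔
      InClass (r ∘ some ∘ some) (s ∘ some ∘ some) τ := by
    have key : ∀ a t, HasStep r (insertAfter none (optionCongr τ)) (some (some a)) t ↔
        HasStep (r ∘ some ∘ some) τ a t := fun a t => by
      have e₁ : insertAfter none (optionCongr τ) (some (some a)) = some (some (τ a)) := by
        rw [insertAfter_of_ne (by simp)]; simp
      have e₂ : (insertAfter none (optionCongr τ)).symm (some (some a)) =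
          some (some (τ.symm a)) := by
        rw [insertAfter_inv_of_ne (by simp), optionCongr_symm_some]
      apply hasStep_congr <;> simp [e₁, e₂]
    constructor
    · exact fun h a => (key _ _).1 (h (some (some a)))
    · rintro h (_ | _ | a)
      · rw [hs]; simpa [HasStep] using h₁
      · rw [hs₁]
        have e₂ : (insertAfter none (optionCongr τ)).symm (some none) = none := by
          rw [Equiv.symm_apply_eq]; simp
        simpa [HasStep, e₂] using h₁
      · exact (key _ _).2 (h a)
  have hb : InClass (r ∘ some ∘ some) (s ∘ some ∘ some) τ → ∀ i, r (some (some i)) < r none →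
      r none < r (some (some (τ i))) := by
    intro h i hi
    have := h.apply_ne_N (hN i hi)
    have := mt (hN (τ i)) this
    have := hr (τ i)
    omega
  have e₂ : ∀ i, (insertAfter (some i) (insertAfter i τ)).symm (some none) = none := by
    intro i
    rw [Equiv.symm_apply_eq]; simp
  have e₃ : ∀ i, insertAfter (some i) (insertAfter i τ) (some none) = some (some (τ i)) := by
    intro i
    rw [insertAfter_of_ne (by simp)]; simp
  have i₁ : ∀ i, InClass r s (insertAfter (some i) (insertAfter i τ)) ↔
      r (some (some i)) < r none ∧ InClass (r ∘ some ∘ some) (s ∘ some ∘ some) τ := by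
    intro i
    constructor
    · intro h
      have hn := h none
      have hj := h (some none)
      have ht := h.apply_ne_N hs₁
      rw [e₃] at ht
      rw [hs] at hn
      rw [hs₁] at hj
      simp only [HasStep, insertAfter_none, insertAfter_inv_none, e₃] at hn hj
      have := mt (hN (τ i)) ht
      have := hr (τ i)
      exact ⟨hn.2, fun a =>
        (hasStep_insertAfter_insertAfter hn.2 h₁ (by omega)).1 (h (some (some a)))⟩
    · rintro ⟨hi, h⟩ (_ | _ | a)
      · rw [hs]
        simpa [HasStep] using ⟨h₁, hi⟩
      · rw [hs₁]
        simpa [HasStep, e₂, e₃] using ⟨h₁.trans (hb h i hi), h₁⟩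
      · exact (hasStep_insertAfter_insertAfter hi h₁ (hb h i hi)).2 (h a)
  simp only [i₀, i₁]
  by_cases hτ : InClass (r ∘ some ∘ some) (s ∘ some ∘ some) τ
  · have w₀ : nodeWeight p q x r (insertAfter none (optionCongr τ)) none = x := by
      unfold nodeWeight
      rw [if_neg (by simpa using h₁.le), if_pos]
      intro b hb
      -- Membership in `β` is preserved by the permutation, that is, it maps cycles to fixed points
      -- of the identity on `Prop`. So the cycle of the peak contains only the two new elements.
      have := sameCycle_map (π := insertAfter none (optionCongr τ)) (σ := (1 : Perm Prop))
        (fun u => ∃ b, u = some (some b)) ?_ hb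
      · rw [Perm.sameCycle_one] at this
        rcases b with _ | _ | b
        · exact le_rfl
        · exact h₁.le
        · simp at this
      · rintro (_ | _ | u)
        · simp
        · simp
        · rw [insertAfter_of_ne (by simp)]; simp
    have w₀' : nodeWeight p q x r (insertAfter none (optionCongr τ)) (some none) = q := by
      unfold nodeWeight
      rw [if_pos (by simpa using h₁)]
    have w₀'' : ∀ a, nodeWeight p q x r (insertAfter none (optionCongr τ)) (some (some a)) =
        nodeWeight p q x (r ∘ some ∘ some) τ a := by
      refine nodeWeight_option_option p q x h₁ hN hτ (fun a => ?_) fun a b => ?_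
      · rw [insertAfter_of_ne (by simp)]; simp
      · rw [sameCycle_insertAfter, sameCycle_optionCongr]
    have w₁ : ∀ i, (if r (some (some i)) < r none then
        ∏ a, nodeWeight p q x r (insertAfter (some i) (insertAfter i τ)) a else 0) =
        if r (some (some i)) < r none then
          p * (q * ∏ a, nodeWeight p q x (r ∘ some ∘ some) τ a) else 0 := by
      intro i
      split_ifs with hi
      · rw [Fintype.prod_option, Fintype.prod_option]
        congr 1
        · unfold nodeWeight
          rw [if_neg (by simpa using h₁.le), if_neg]
          intro H
          -- The element `τ i`, two steps after the peak, is larger than it, so the peak has weight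
          -- `p`.
          refine absurd (hb hτ i hi) (H (some (some (τ i))) ⟨2, ?_⟩).not_gt
          rw [zpow_two, Perm.mul_apply, insertAfter_none, insertAfter_self, e₃]
        congr 1
        · unfold nodeWeight
          rw [if_pos]
          rw [e₃]
          exact h₁.trans (hb hτ i hi)
        refine prod_congr rfl fun a _ => ?_
        refine nodeWeight_option_option p q x h₁ hN hτ (fun a => ?_) (fun a b => ?_) a
        · by_cases ha : a = i
          · subst ha
            have := hb hτ a hi
            rw [insertAfter_self]
            omega
          · rw [insertAfter_of_ne (by simpa using ha), insertAfter_of_ne ha]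
        · rw [sameCycle_insertAfter, sameCycle_insertAfter]
      · rfl
    simp only [hτ, and_true, if_true, w₁]
    simp only [Fintype.prod_option, w₀, w₀', w₀'']
    rw [← sum_filter, sum_const, nsmul_eq_mul]
    ring
  · simp [hτ]

end Peak

/-! ### Completions of partial arc diagrams with `h` open paths -/

section Completions

/-- The ranks of `h` elements contracted to the left end, and of `m` nodes. -/
def completionRank (h m : ℕ) : Fin h ⊕ Fin m → ℕ :=
  Sum.elim (fun _ => 0) fun k => k + 1

/-- The shapes of `h` valleys at the left end, and of the nodes. -/
def completionStep (h : ℕ) {m : ℕ} (s : Fin m → Step) : Fin h ⊕ Fin m → Step :=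
  Sum.elim (fun _ => .N) s

/-- The first node, and the other elements. -/
def nodeEquiv (h m : ℕ) : Option (Fin h ⊕ Fin m) ≃ Fin h ⊕ Fin (m + 1) where
  toFun a := a.elim (.inr 0) (Sum.map id Fin.succ)
  invFun := Sum.elim (some ∘ .inl) (Fin.cases none (some ∘ .inr))
  left_inv := by rintro (_ | a | k) <;> simp
  right_inv := by
    rintro (a | k)
    · simp
    · cases k using Fin.cases <;> simp

/-- The left end `j`, and the other elements. -/
def endEquiv {h : ℕ} (m : ℕ) (j : Fin (h + 1)) :
    Option (Fin h ⊕ Fin m) ≃ Fin (h + 1) ⊕ Fin m where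
  toFun a := a.elim (.inl j) (Sum.map j.succAbove id)
  invFun := Sum.elim (fun a => ((finSuccEquiv' j) a).map .inl) (some ∘ .inr)
  left_inv := by rintro (_ | a | k) <;> simp
  right_inv := by
    rintro (a | k)
    · obtain ⟨a, rfl⟩ := (finSuccEquiv' j).symm.surjective a
      cases a <;> simp
    · simp

@[simp] theorem nodeEquiv_none (h m : ℕ) : nodeEquiv h m none = .inr 0 := rfl
@[simp] theorem nodeEquiv_inl {h m : ℕ} (a : Fin h) :
    nodeEquiv h m (some (.inl a)) = .inl a := rfl
@[simp] theorem nodeEquiv_inr {h m : ℕ} (k : Fin m) :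
    nodeEquiv h m (some (.inr k)) = .inr k.succ := rfl
@[simp] theorem endEquiv_none {h m : ℕ} (j : Fin (h + 1)) : endEquiv m j none = .inl j := rfl
@[simp] theorem endEquiv_inl {h m : ℕ} (j : Fin (h + 1)) (a : Fin h) :
    endEquiv m j (some (.inl a)) = .inl (j.succAbove a) := rfl
@[simp] theorem endEquiv_inr {h m : ℕ} (j : Fin (h + 1)) (k : Fin m) :
    endEquiv m j (some (.inr k)) = .inr k := rfl
@[simp] theorem completionRank_inl {h m : ℕ} (a : Fin h) :
    completionRank h m (.inl a) = 0 := rfl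
@[simp] theorem completionRank_inr {h m : ℕ} (k : Fin m) :
    completionRank h m (.inr k) = k + 1 := rfl
@[simp] theorem completionStep_inl {h m : ℕ} (s : Fin m → Step) (a : Fin h) :
    completionStep h s (.inl a) = .N := rfl
@[simp] theorem completionStep_inr {h m : ℕ} (s : Fin m → Step) (k : Fin m) :
    completionStep h s (.inr k) = s k := rfl

variable {R : Type*} [CommRing R] (p q x : R)

/-- The total weight of the completions by `m` nodes with the local shapes `s`. -/
noncomputable def completionWeight (h : ℕ) {m : ℕ} (s : Fin m → Step) : R :=
  wordWeight p q x (completionRank h m) (completionStep h s)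

variable {h m : ℕ} {s : Fin (m + 1) → Step}

/-- The first node is lowered to rank `0` and becomes one more left end; only comparisons between
valleys change. -/
theorem completionWeight_N (hs : s 0 = .N) :
    completionWeight p q x h s = completionWeight p q x (h + 1) (Fin.tail s) := by
  unfold completionWeight
  rw [← wordWeight_comp_equiv _ _ _ _ _ (nodeEquiv h m),
    ← wordWeight_comp_equiv _ _ _ _ _ (endEquiv m (0 : Fin (h + 1)))]
  have : completionStep h s ∘ nodeEquiv h m =
      completionStep (h + 1) (Fin.tail s) ∘ endEquiv m 0 := by
    funext a
    rcases a with _ | a | k <;> simp [hs, Fin.tail]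
  rw [this]
  refine wordWeight_congr_rank p q x ?_
  rintro (_ | a | k) (_ | b | l) <;> simp

theorem card_lt_completionRank :
    #{a : Fin h ⊕ Fin m | (completionRank h (m + 1) ∘ nodeEquiv h m) (some a) <
      (completionRank h (m + 1) ∘ nodeEquiv h m) none} = h := by
  rw [show ({a : Fin h ⊕ Fin m | _} : Finset _) = univ.map Function.Embedding.inl from ?_]
  · simp
  · ext (a | k) <;> simp

theorem wordWeight_completion_tail :
    wordWeight p q x ((completionRank h (m + 1) ∘ nodeEquiv h m) ∘ some)
      ((completionStep h s ∘ nodeEquiv h m) ∘ some) = completionWeight p q x h (Fin.tail s) := by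
  have : (completionStep h s ∘ nodeEquiv h m) ∘ some = completionStep h (Fin.tail s) := by
    funext a
    rcases a with a | k <;> simp [Fin.tail]
  rw [this]
  refine wordWeight_congr_rank p q x ?_
  rintro (a | k) (b | l) <;> simp

theorem completionWeight_E (hs : s 0 = .E) :
    completionWeight p q x h s = (h * q + x) * completionWeight p q x h (Fin.tail s) := by
  rw [completionWeight, ← wordWeight_comp_equiv _ _ _ _ _ (nodeEquiv h m), wordWeight_option_E,
    card_lt_completionRank, wordWeight_completion_tail]
  · rintro (a | k) <;> simp
  · rintro (a | k) <;> simp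
  · simpa using hs

theorem completionWeight_F (hs : s 0 = .F) :
    completionWeight p q x h s = h * p * completionWeight p q x h (Fin.tail s) := by
  rw [completionWeight, ← wordWeight_comp_equiv _ _ _ _ _ (nodeEquiv h m), wordWeight_option_F,
    card_lt_completionRank, wordWeight_completion_tail]
  · rintro (a | k) <;> simp
  · rintro (a | k) <;> simp
  · simpa using hs

theorem InClass.exists_apply_inr_zero {π : Perm (Fin h ⊕ Fin (m + 1))} (hs : s 0 = .S)
    (hπ : InClass (completionRank h (m + 1)) (completionStep h s) π) :
    ∃ j, π (.inr 0) = .inl j := by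
  have := hπ (.inr 0)
  rw [completionStep_inr, hs] at this
  have h₁ := this.1
  rcases hk : π (.inr 0) with j | k
  · exact ⟨j, rfl⟩
  · simp [hk] at h₁

theorem completionWeight_zero_S (hs : s 0 = .S) : completionWeight p q x 0 s = 0 := by
  refine sum_eq_zero fun π _ => if_neg fun hπ => ?_
  obtain ⟨j, -⟩ := hπ.exists_apply_inr_zero hs
  exact j.elim0

/-- The peak is the smallest node, so its successor is one of the `h + 1` left ends. Removing the
peak alone would make two valleys adjacent or leave a fixed valley, so the successor is removed with
it. -/
theorem completionWeight_succ_S (hs : s 0 = .S) :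
    completionWeight p q x (h + 1) s =
      (h + 1) * q * ((h * p + x) * completionWeight p q x h (Fin.tail s)) := by
  classical
  have hj : ∀ j : Fin (h + 1), (∑ π : Perm (Fin (h + 1) ⊕ Fin (m + 1)),
      if π (.inr 0) = .inl j then
        classTerm p q x (completionRank (h + 1) (m + 1)) (completionStep (h + 1) s) π else 0) =
      q * ((h * p + x) * completionWeight p q x h (Fin.tail s)) := by
    intro j
    set e : Option (Option (Fin h ⊕ Fin m)) ≃ Fin (h + 1) ⊕ Fin (m + 1) :=
      (optionCongr (endEquiv m j)).trans (nodeEquiv (h + 1) m) with he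
    have hn : e none = .inr 0 := rfl
    have hsn : e (some none) = .inl j := rfl
    have hl : ∀ a, e (some (some (.inl a))) = .inl (j.succAbove a) := fun _ => rfl
    have hr : ∀ k, e (some (some (.inr k))) = .inr k.succ := fun _ => rfl
    rw [← (e.permCongr).sum_comp]
    have hc : ∀ σ : Perm (Option (Option (Fin h ⊕ Fin m))),
        e.permCongr σ (.inr 0) = .inl j ↔ σ none = some none := by
      intro σ
      rw [← hn, ← hsn]
      simp
    simp only [hc, ← classTerm_comp_equiv]
    rw [sum_peak_option p q x]
    · have h₁ : #{a : Fin h ⊕ Fin m | (completionRank (h + 1) (m + 1) ∘ e) (some (some a)) <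
          (completionRank (h + 1) (m + 1) ∘ e) none} = h := by
        rw [show ({a : Fin h ⊕ Fin m | _} : Finset _) = univ.map Function.Embedding.inl from ?_]
        · simp
        · ext (a | k) <;> simp [hl, hr, hn]
      have h₂ : (completionStep (h + 1) s ∘ e) ∘ some ∘ some = completionStep h (Fin.tail s) := by
        funext a
        rcases a with a | k <;> simp [Fin.tail, hl, hr]
      rw [h₁, h₂, wordWeight_congr_rank (r' := completionRank h m), completionWeight]
      · ring
      · rintro (a | k) (b | l) <;> simp [hl, hr]
    · rintro (a | k) <;> simp [hl, hr, hn]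
    · simp [hn, hsn]
    · rintro (a | k) <;> simp [hl, hr, hn]
    · simpa [hn] using hs
    · simp [hsn]
  have : completionWeight p q x (h + 1) s = ∑ j : Fin (h + 1),
      ∑ π : Perm (Fin (h + 1) ⊕ Fin (m + 1)), if π (.inr 0) = .inl j then
        classTerm p q x (completionRank (h + 1) (m + 1)) (completionStep (h + 1) s) π else 0 := by
    rw [sum_comm]
    refine sum_congr rfl fun π _ => ?_
    by_cases hπ : InClass (completionRank (h + 1) (m + 1)) (completionStep (h + 1) s) π
    · obtain ⟨j, hj⟩ := hπ.exists_apply_inr_zero hs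
      simp [hj]
    · simp [classTerm, hπ]
  rw [this, sum_congr rfl fun j _ => hj j, sum_const, card_univ, Fintype.card_fin, nsmul_eq_mul]
  push_cast
  ring

/-- A left end has to rise, and without nodes there is nothing to rise to. -/
theorem completionWeight_fin_zero (s : Fin 0 → Step) :
    completionWeight p q x h s = if h = 0 then 1 else 0 := by
  split_ifs with h0
  · subst h0
    have hc : ∀ π, InClass (completionRank 0 0) (completionStep 0 s) π := fun π a => isEmptyElim a
    simp [completionWeight, wordWeight, classTerm, hc]
  · refine sum_eq_zero fun π _ => if_neg fun hπ => ?_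
    have := hπ (.inl ⟨0, Nat.pos_of_ne_zero h0⟩)
    have h₁ := this.1
    rcases hk : π (.inl ⟨0, Nat.pos_of_ne_zero h0⟩) with j | k
    · simp [hk] at h₁
    · exact k.elim0

/-- The weight of a path from height `h` that begins with the given step, where `f` is the weight
of the rest of the path in terms of the height at which it begins. -/
def stepTransfer : Step → (ℕ → R) → ℕ → R
  | .N, f, h => (h + 1) * q * f (h + 1)
  | .S, _, 0 => 0
  | .S, f, h + 1 => (h * p + x) * f h
  | .E, f, h => (h * q + x) * f h
  | .F, f, h => h * p * f h

/-- The weight of a word of steps as a path from height `h` to height `0`; it vanishes if the word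
is not such a path. -/
def pathWeight : (m : ℕ) → ℕ → (Fin m → Step) → R
  | 0, h, _ => if h = 0 then 1 else 0
  | m + 1, h, s => stepTransfer p q x (s 0) (fun h => pathWeight m h (Fin.tail s)) h

/-- A completion pays `(h + 1) q` when a left end is used up by an S step, a path pays it at the N
step. The factor `h! q ^ h` is what the `h` valleys already present still owe. -/
theorem completionWeight_eq (h : ℕ) {m : ℕ} (s : Fin m → Step) :
    completionWeight p q x h s = h.factorial * q ^ h * pathWeight p q x m h s := by
  induction m generalizing h with
  | zero =>
    rw [completionWeight_fin_zero, pathWeight]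
    split_ifs with h0
    · simp [h0]
    · simp
  | succ m ih =>
    rcases hs : s 0 with _ | _ | _ | _
    · rw [completionWeight_N p q x hs, ih, pathWeight, hs, stepTransfer, Nat.factorial_succ]
      push_cast
      ring
    · cases h with
      | zero => rw [completionWeight_zero_S p q x hs, pathWeight, hs, stepTransfer, mul_zero]
      | succ h =>
        rw [completionWeight_succ_S p q x hs, ih, pathWeight, hs, stepTransfer, Nat.factorial_succ]
        push_cast
        ring
    · rw [completionWeight_E p q x hs, ih, pathWeight, hs, stepTransfer]
      ring
    · rw [completionWeight_F p q x hs, ih, pathWeight, hs, stepTransfer]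
      ring

end Completions

/-- The total weight of the permutations of `Fin n` with prescribed local shapes. -/
theorem wordWeight_fin {R : Type*} [CommRing R] (p q x : R) {n : ℕ} (s : Fin n → Step) :
    wordWeight p q x Fin.val s = pathWeight p q x n 0 s := by
  have := completionWeight_eq p q x 0 s
  rw [Nat.factorial_zero, Nat.cast_one, pow_zero, one_mul, one_mul] at this
  rw [← this, completionWeight,
    ← wordWeight_comp_equiv _ _ _ _ _ (Equiv.emptySum (Fin 0) (Fin n)).symm]
  exact wordWeight_congr_rank p q x fun a b => .inr (by simp)

/-! ### Weights of Motzkin paths -/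

theorem height_zero {n : ℕ} (s : Fin n → Step) : height s 0 = 0 := by
  simp [height]

theorem height_succ_tail {m : ℕ} (s : Fin (m + 1) → Step) (k : ℕ) :
    height s (k + 1) = (s 0).rise + height (Fin.tail s) k := by
  simp only [height, sum_filter, Fin.sum_univ_succ, Fin.tail]
  simp

/-- The word `s` is a path from height `h` to height `0` that never goes below height `0`, and
none of its `F` steps starts at height `0`. -/
def IsPathFrom (h : ℤ) {n : ℕ} (s : Fin n → Step) : Prop :=
  (∀ k ≤ n, 0 ≤ h + height s k) ∧ h + height s n = 0 ∧
    ∀ k : Fin n, s k = .F → h + height s k ≠ 0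

theorem isPathFrom_zero {h : ℤ} {s : Fin 0 → Step} : IsPathFrom h s ↔ h = 0 := by
  simp only [IsPathFrom, Nat.le_zero, forall_eq, height_zero, add_zero, IsEmpty.forall_iff,
    and_true]
  omega

theorem isPathFrom_succ {h : ℤ} {m : ℕ} {s : Fin (m + 1) → Step} :
    IsPathFrom h s ↔ 0 ≤ h ∧ (s 0 = .F → h ≠ 0) ∧ IsPathFrom (h + (s 0).rise) (Fin.tail s) := by
  have e : ∀ k, h + height s (k + 1) = h + (s 0).rise + height (Fin.tail s) k := fun k => by
    rw [height_succ_tail, add_assoc]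
  simp only [IsPathFrom, Fin.forall_fin_succ, Fin.val_zero, Fin.val_succ, e, height_zero, add_zero]
  constructor
  · rintro ⟨h₁, h₂, h₃, h₄⟩
    refine ⟨by simpa [height_zero] using h₁ 0 (by omega), h₃, fun k hk => ?_, h₂, h₄⟩
    rw [← e]
    exact h₁ (k + 1) (by omega)
  · rintro ⟨h₁, h₃, h₂, h₄, h₅⟩
    refine ⟨fun k hk => ?_, h₄, h₃, h₅⟩
    cases k with
    | zero => simpa [height_zero] using h₁
    | succ k =>
      rw [e]
      exact h₂ k (by omega)

section

variable {R : Type*} [CommRing R] (p q x : R)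

theorem pathWeight_eq_prod {m h : ℕ} {s : Fin m → Step} (hs : IsPathFrom h s) :
    pathWeight p q x m h s = ∏ k : Fin m, stepWeight p q x (h + height s k) (s k) := by
  induction m generalizing h with
  | zero =>
    rw [isPathFrom_zero] at hs
    simp [pathWeight, Int.natCast_eq_zero.1 hs]
  | succ m ih =>
    obtain ⟨-, h₂, h₃⟩ := isPathFrom_succ.1 hs
    have key : ∀ h' : ℕ, (h' : ℤ) = h + (s 0).rise → pathWeight p q x m h' (Fin.tail s) =
        ∏ k : Fin m, stepWeight p q x (h + height s k.succ) (s k.succ) := by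
      intro h' e
      rw [← e] at h₃
      rw [ih h₃]
      refine prod_congr rfl fun k _ => ?_
      rw [Fin.val_succ, height_succ_tail, e, add_assoc, Fin.tail]
    rw [Fin.prod_univ_succ, pathWeight, Fin.val_zero, height_zero, add_zero]
    rcases h0 : s 0 with _ | _ | _ | _ <;> rw [h0] at key
    · simp [stepTransfer, stepWeight, key (h + 1) (by simp [Step.rise])]
    · cases h with
      | zero =>
        rw [h0] at h₃
        have := h₃.1 0 (Nat.zero_le _)
        simp [height_zero, Step.rise] at this
      | succ h => simp [stepTransfer, stepWeight, key h (by simp [Step.rise])]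
    · simp [stepTransfer, stepWeight, key h (by simp [Step.rise])]
    · simp [stepTransfer, stepWeight, key h (by simp [Step.rise])]

theorem isPathFrom_of_pathWeight_ne_zero {m h : ℕ} {s : Fin m → Step}
    (hs : pathWeight p q x m h s ≠ 0) : IsPathFrom h s := by
  induction m generalizing h with
  | zero =>
    rw [isPathFrom_zero]
    by_contra h0
    rw [Int.natCast_eq_zero] at h0
    simp [pathWeight, h0] at hs
  | succ m ih =>
    rw [isPathFrom_succ]
    refine ⟨by positivity, ?_⟩
    rw [pathWeight] at hs
    rcases h0 : s 0 with _ | _ | _ | _ <;> rw [h0] at hs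
    · exact ⟨by simp, by simpa [Step.rise] using ih (right_ne_zero_of_mul hs)⟩
    · cases h with
      | zero => simp [stepTransfer] at hs
      | succ h => exact ⟨by simp, by simpa [Step.rise] using ih (right_ne_zero_of_mul hs)⟩
    · exact ⟨by simp, by simpa [Step.rise] using ih (right_ne_zero_of_mul hs)⟩
    · refine ⟨?_, by simpa [Step.rise] using ih (right_ne_zero_of_mul hs)⟩
      rintro - h0
      simp [stepTransfer, Int.natCast_eq_zero.1 h0] at hs

theorem pathWeight_pos {m h : ℕ} {s : Fin m → Step} (hs : IsPathFrom h s) :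
    0 < pathWeight (1 : ℤ) 1 1 m h s := by
  induction m generalizing h with
  | zero =>
    rw [isPathFrom_zero] at hs
    simp [pathWeight, Int.natCast_eq_zero.1 hs]
  | succ m ih =>
    obtain ⟨-, h₂, h₃⟩ := isPathFrom_succ.1 hs
    have key : ∀ h' : ℕ, (h' : ℤ) = h + (s 0).rise →
        0 < pathWeight (1 : ℤ) 1 1 m h' (Fin.tail s) := fun h' e => ih (e ▸ h₃)
    rw [pathWeight]
    rcases h0 : s 0 with _ | _ | _ | _ <;> rw [h0] at key
    · exact mul_pos (by positivity) (key (h + 1) (by simp [Step.rise]))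
    · cases h with
      | zero =>
        rw [h0] at h₃
        have := h₃.1 0 (Nat.zero_le _)
        simp [height_zero, Step.rise] at this
      | succ h => exact mul_pos (by positivity) (key h (by simp [Step.rise]))
    · exact mul_pos (by positivity) (key h (by simp [Step.rise]))
    · have := h₂ h0
      exact mul_pos (by positivity) (key h (by simp [Step.rise]))

end

/-! ### The continued fraction -/

instance : Fintype Step where
  elems := ⟨{.N, .S, .E, .F}, by simp⟩
  complete := by rintro (_ | _ | _ | _) <;> simp

theorem sum_step {M : Type*} [AddCommMonoid M] (f : Step → M) :
    ∑ t, f t = f .N + f .S + f .E + f .F := by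
  change Multiset.sum (Multiset.map f {.N, .S, .E, .F}) = _
  simp [add_assoc]

section

variable {R : Type*} [CommRing R] (p q x : R)

/-- The total weight of the paths of length `n` from height `h` to height `0`. -/
noncomputable def pathSum (n h : ℕ) : R :=
  ∑ s : Fin n → Step, pathWeight p q x n h s

theorem pathSum_zero (h : ℕ) : pathSum p q x 0 h = if h = 0 then 1 else 0 := by
  simp [pathSum, pathWeight]

theorem pathSum_succ (n h : ℕ) :
    pathSum p q x (n + 1) h = (h + 1) * q * pathSum p q x n (h + 1) +
      stepTransfer p q x .S (pathSum p q x n) h + (h * q + h * p + x) * pathSum p q x n h := by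
  have : ∀ t, ∑ s : Fin n → Step, pathWeight p q x (n + 1) h (Fin.cons t s) =
      stepTransfer p q x t (pathSum p q x n) h := by
    intro t
    simp only [pathWeight, Fin.cons_zero, Fin.tail_cons]
    cases t <;> cases h <;> simp [stepTransfer, pathSum, mul_sum]
  have hcons : ∀ y : Step × (Fin n → Step),
      (Fin.consEquiv fun _ => Step) y = (Fin.cons y.1 y.2 : Fin (n + 1) → Step) := fun _ => rfl
  rw [pathSum, ← (Fin.consEquiv fun _ => Step).sum_comp, Fintype.sum_prod_type]
  simp only [hcons, this, sum_step]
  simp only [stepTransfer]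
  ring

/-- The contribution of the paths that start at height `h` to the `m`-th convergent. -/
noncomputable def convergentFrom (b c d : ℕ → R) (m : ℕ) : ℕ → PowerSeries R
  | 0 => jConvergent b c m 0
  | h + 1 => PowerSeries.C (d (h + 1)) * PowerSeries.X * jConvergent b c (m - (h + 1)) (h + 1) *
      convergentFrom b c d m h

open PowerSeries in
-- This is the decomposition of paths by their first step. Algebraically it is the quotient identity
-- of level `h`, multiplied by the contribution of the descent from there; `hm` says that level `h`
-- is not truncated.
theorem convergentFrom_eq (a b c d : ℕ → R) (hc : ∀ h, c (h + 1) = a h * d (h + 1)) {m h : ℕ}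
    (hm : h < m) :
    convergentFrom b c d m h = (if h = 0 then 1 else C (d h) * X * convergentFrom b c d m (h - 1)) +
      X * (C (b h) * convergentFrom b c d m h + C (a h) * convergentFrom b c d m (h + 1)) := by
  have hJ := jConvergent_succ_mul b c (m - (h + 1)) h
  rw [show m - (h + 1) + 1 = m - h by omega, hc, map_mul] at hJ
  cases h with
  | zero =>
    simp only [convergentFrom, if_true]
    rw [Nat.sub_zero] at hJ
    linear_combination hJ
  | succ h =>
    simp only [convergentFrom, Nat.succ_ne_zero, if_false, Nat.add_sub_cancel]
    linear_combination (C (d (h + 1)) * X * convergentFrom b c d m h) * hJ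

open PowerSeries in
-- A path of length `n` from height `h` stays below height `m`, so the truncation does not affect
-- it. The numerators split as an N weight `(h + 1) q` times an S weight `h p + x`.
theorem coeff_convergentFrom (b c : ℕ → R) (hb : ∀ h : ℕ, b h = h * q + h * p + x)
    (hc : ∀ h : ℕ, c (h + 1) = (h + 1) * q * (h * p + x)) {m n h : ℕ} (hm : n + h < m) :
    coeff n (convergentFrom b c (fun h => ((h : R) - 1) * p + x) m h) = pathSum p q x n h := by
  have hc' : ∀ h : ℕ, c (h + 1) =
      (fun h : ℕ => ((h : R) + 1) * q) h * (fun h : ℕ => ((h : R) - 1) * p + x) (h + 1) := by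
    intro h
    rw [hc]
    push_cast
    ring
  induction n generalizing h with
  | zero =>
    rw [convergentFrom_eq _ b c _ hc' (by omega), pathSum_zero]
    cases h <;> simp [mul_assoc]
  | succ n ih =>
    rw [convergentFrom_eq _ b c _ hc' (by omega), pathSum_succ, map_add (coeff (n + 1)),
      coeff_succ_X_mul, map_add (coeff n),
      coeff_C_mul, coeff_C_mul, ih (by omega), ih (by omega), hb]
    cases h with
    | zero =>
      simp [stepTransfer]
      ring
    | succ h =>
      rw [if_neg (by omega), Nat.add_sub_cancel, mul_assoc, coeff_C_mul, coeff_succ_X_mul,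
        ih (by omega), stepTransfer]
      push_cast
      ring

theorem hasJFraction_pathSum :
    HasJFraction (PowerSeries.mk fun n => pathSum p q x n 0)
      (fun h : ℕ => (h : R) * q + (h : R) * p + x)
      (fun h : ℕ => (h : R) * q * (((h : R) - 1) * p + x)) := by
  intro n
  filter_upwards [Filter.eventually_gt_atTop n] with m hm
  rw [PowerSeries.coeff_mk, ← coeff_convergentFrom p q x _ _ (fun _ => rfl) (fun h => ?_)
    (show n + 0 < m from hm), convergentFrom]
  push_cast
  ring

end

/-! ### The standard cycle form -/

section CycleForm

variable {n : ℕ} (π : Perm (Fin n))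

theorem exists_sameCycle_isCycleMin (a : Fin n) : ∃ c, π.SameCycle a c ∧ IsCycleMin π c := by
  classical
  obtain ⟨c, hc, hmin⟩ := ({c | π.SameCycle a c} : Finset (Fin n)).exists_min_image id
    ⟨a, by simp [Perm.SameCycle.rfl]⟩
  rw [mem_filter_univ] at hc
  exact ⟨c, hc, fun b hb => hmin b (by simpa using hc.trans hb)⟩

variable {π}

theorem IsCycleMin.eq_of_sameCycle {a b : Fin n} (ha : IsCycleMin π a) (hb : IsCycleMin π b)
    (h : π.SameCycle a b) : a = b :=
  le_antisymm (ha b h) (hb a h.symm)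

theorem iterate_sameCycle (a : Fin n) (t : ℕ) : π.SameCycle a (π^[t] a) :=
  ⟨t, by simp [Perm.iterate_eq_pow]⟩

theorem minimalPeriod_pos (a : Fin n) : 0 < Function.minimalPeriod π a :=
  Function.minimalPeriod_pos_of_mem_periodicPts (π.injective.mem_periodicPts a)

theorem exists_iterate_lt_minimalPeriod {a b : Fin n} (h : π.SameCycle a b) :
    ∃ t < Function.minimalPeriod π a, π^[t] a = b := by
  obtain ⟨t, rfl⟩ := h.exists_nat_pow_eq
  exact ⟨t % Function.minimalPeriod π a, Nat.mod_lt _ (minimalPeriod_pos a), by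
    rw [Function.iterate_mod_minimalPeriod_eq, Perm.iterate_eq_pow]⟩

theorem zip_tail_cycleWord (c : Fin n) :
    (cycleWord π c).zip (cycleWord π c).tail =
      (List.range (Function.minimalPeriod π c - 1)).map fun t => (π^[t] c, π^[t + 1] c) := by
  apply List.ext_getElem
  · simp [cycleWord]
  · intro t _ _
    simp [cycleWord]

/-- The only step missing from a cycle word is the one back to its first letter, which is the step
into the cycle minimum. -/
theorem mem_arcs {a b : Fin n} : (a, b) ∈ arcs π ↔ π a = b ∧ ¬ IsCycleMin π b := by
  simp only [arcs, standardCycleForm, List.mem_flatMap, List.mem_map, List.mem_filter,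
    List.mem_reverse, List.mem_finRange, true_and, decide_eq_true_eq, exists_exists_and_eq_and,
    zip_tail_cycleWord, List.mem_range, Prod.mk.injEq]
  constructor
  · rintro ⟨c, hc, t, ht, rfl, rfl⟩
    refine ⟨(Function.iterate_succ_apply' _ _ _).symm, fun hm => ?_⟩
    exact Function.not_isPeriodicPt_of_pos_of_lt_minimalPeriod (n := t + 1) (by omega) (by omega)
      (hc.eq_of_sameCycle hm (iterate_sameCycle c _)).symm
  · rintro ⟨rfl, hb⟩
    obtain ⟨c, hac, hc⟩ := exists_sameCycle_isCycleMin π a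
    obtain ⟨t, ht, rfl⟩ := exists_iterate_lt_minimalPeriod hac.symm
    rw [← Function.iterate_succ_apply' π] at hb
    refine ⟨c, hc, t, ?_, rfl, Function.iterate_succ_apply' _ _ _⟩
    by_contra hlt
    rw [show t.succ = Function.minimalPeriod π c by omega, Function.iterate_minimalPeriod] at hb
    exact hb hc

theorem nodup_arcs : (arcs π).Nodup := by
  classical
  rw [arcs, standardCycleForm, List.flatMap_map, List.nodup_flatMap]
  constructor
  · intro c _
    rw [zip_tail_cycleWord]
    refine List.Nodup.map_on ?_ List.nodup_range
    intro t ht u hu h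
    rw [List.mem_range] at ht hu
    exact Function.iterate_injOn_Iio_minimalPeriod (f := π) (x := c)
      (Set.mem_Iio.2 (by omega)) (Set.mem_Iio.2 (by omega)) (Prod.mk.inj h).1
  · refine List.Nodup.pairwise_of_forall_ne
      ((List.nodup_reverse.2 (List.nodup_finRange n)).filter _) fun c hc d hd hcd => ?_
    simp only [List.mem_filter, decide_eq_true_eq] at hc hd
    rintro ⟨a, b⟩ h₁ h₂
    simp only [zip_tail_cycleWord, List.mem_map, Prod.mk.injEq] at h₁ h₂
    obtain ⟨t, -, rfl, -⟩ := h₁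
    obtain ⟨u, -, h, -⟩ := h₂
    exact hcd (hc.2.eq_of_sameCycle hd.2
      ((iterate_sameCycle c t).trans (h ▸ iterate_sameCycle d u).symm))

open Classical in
theorem countP_arcs (P : Fin n × Fin n → Bool) :
    (arcs π).countP P = #{a | P (a, π a) ∧ ¬ IsCycleMin π (π a)} := by
  rw [List.countP_eq_length_filter, ← List.toFinset_card_of_nodup (nodup_arcs.filter _)]
  refine card_bij' (fun e _ => e.1) (fun a _ => (a, π a)) ?_ ?_ ?_ ?_
  · rintro ⟨a, b⟩ h
    simp only [List.mem_toFinset, List.mem_filter, mem_arcs] at h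
    obtain ⟨⟨rfl, h₁⟩, h₂⟩ := h
    simpa using ⟨h₂, h₁⟩
  · intro a h
    simp only [mem_filter_univ] at h
    simpa [mem_arcs] using h.symm
  · rintro ⟨a, b⟩ h
    simp only [List.mem_toFinset, List.mem_filter, mem_arcs] at h
    simp [h.1.1]
  · simp

theorem not_isCycleMin_apply {a : Fin n} (h : a < π a) : ¬ IsCycleMin π (π a) :=
  fun hm => (hm a ⟨-1, by simp⟩).not_gt h

open Classical in
theorem asc_eq : asc π = #{a | a < π a} := by
  rw [asc, countP_arcs]
  congr 1
  ext a
  simpa using not_isCycleMin_apply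

theorem isCycleMin_of_apply_eq {a : Fin n} (h : π a = a) : IsCycleMin π a := by
  rintro b ⟨k, hk⟩
  rw [Perm.zpow_apply_eq_self_of_apply_eq_self h] at hk
  exact hk.le

-- A fixed point is its own cycle minimum, so excluding the closing steps leaves only strict
-- descents.
open Classical in
theorem des_eq : des π = #{a | ¬ a < π a ∧ ¬ IsCycleMin π (π a)} := by
  rw [des, countP_arcs]
  congr 1
  ext a
  simp only [decide_eq_true_eq, mem_filter_univ, not_lt, and_congr_left_iff]
  intro hm
  refine ⟨le_of_lt, fun h => h.lt_of_ne fun he => hm ?_⟩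
  rw [he]
  exact isCycleMin_of_apply_eq he

open Classical in
theorem cyc_eq : cyc π = #{a | IsCycleMin π a} := by
  rw [cyc, standardCycleForm, List.length_map,
    ← List.toFinset_card_of_nodup ((List.nodup_reverse.2 (List.nodup_finRange n)).filter _)]
  congr 1
  ext a
  simp

-- Used for both minima and maxima, to see that a permutation has equally many of each.
open Classical in
theorem card_transversal {P : Fin n → Prop} (hP : ∀ a, ∃ b, π.SameCycle a b ∧ P b)
    (huniq : ∀ a b, P a → P b → π.SameCycle a b → a = b) :
    #{a | P a} = Fintype.card (Quotient (Perm.SameCycle.setoid π)) := by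
  rw [← card_univ]
  refine card_bij (fun a _ => Quotient.mk (Perm.SameCycle.setoid π) a) (by simp) ?_ ?_
  · intro a ha b hb h
    simp only [mem_filter_univ] at ha hb
    exact huniq a b ha hb (Quotient.exact h)
  · intro c _
    obtain ⟨a, rfl⟩ := Quotient.exists_rep c
    obtain ⟨b, hab, hb⟩ := hP a
    exact ⟨b, by simpa using hb, Quotient.sound hab.symm⟩

/-- `a` is the largest element of its cycle. -/
def IsCycleMax (π : Perm (Fin n)) (a : Fin n) : Prop :=
  ∀ b : Fin n, π.SameCycle a b → b ≤ a

open Classical in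
theorem card_isCycleMax : #{a | IsCycleMax π a} = cyc π := by
  rw [cyc_eq]
  refine (card_transversal ?_ ?_).trans (card_transversal (exists_sameCycle_isCycleMin π)
    fun a b ha hb h => ha.eq_of_sameCycle hb h).symm
  · intro a
    obtain ⟨c, hc, hmax⟩ := ({c | π.SameCycle a c} : Finset (Fin n)).exists_max_image id
      ⟨a, by simp [Perm.SameCycle.rfl]⟩
    rw [mem_filter_univ] at hc
    exact ⟨c, hc, fun b hb => hmax b (by simpa using hc.trans hb)⟩
  · exact fun a b ha hb h => le_antisymm (hb a h.symm) (ha b h)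

theorem permWeight_eq {R : Type*} [CommRing R] (p q x : R) :
    permWeight p q x π = ∏ a, nodeWeight p q x Fin.val π a := by
  classical
  have hx : #{a | ¬ a < π a ∧ IsCycleMax π a} = cyc π := by
    rw [← card_isCycleMax]
    congr 1
    ext a
    simp only [mem_filter_univ, and_iff_right_iff_imp]
    exact fun h => (h (π a) ⟨1, by simp⟩).not_gt
  have hmin : #{a | ¬ a < π a ∧ IsCycleMin π (π a)} = cyc π := by
    rw [cyc_eq]
    refine card_bij (fun a _ => π a) (by simp) (by simp) fun b hb => ?_
    simp only [mem_filter_univ] at hb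
    exact ⟨π.symm b, by simpa using ⟨hb _ ⟨-1, by simp⟩, hb⟩, by simp⟩
  have hp : #{a | ¬ a < π a ∧ ¬ IsCycleMax π a} = des π := by
    -- The non-ascents are counted twice: by whether they start at a cycle maximum, and by whether
    -- they close a cycle. Both first parts have `cyc π` elements, so the remainders agree.
    have h₁ := card_filter_add_card_filter_not (s := ({a | ¬ a < π a} : Finset (Fin n)))
      fun a => IsCycleMax π a
    have h₂ := card_filter_add_card_filter_not (s := ({a | ¬ a < π a} : Finset (Fin n)))
      fun a => IsCycleMin π (π a)
    rw [filter_filter, filter_filter] at h₁ h₂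
    rw [des_eq]
    omega
  have hw : permWeight p q x π = q ^ asc π * (x ^ cyc π * p ^ des π) := by
    rw [permWeight]
    ring
  rw [hw, ← hx, ← hp, asc_eq]
  have key : ∀ a, nodeWeight p q x Fin.val π a =
      if a < π a then q else if IsCycleMax π a then x else p := fun a => by
    simp only [nodeWeight, IsCycleMax, Fin.val_fin_lt, Fin.val_fin_le]
    congr
  simp only [key]
  rw [prod_ite, prod_ite, prod_const, prod_const, prod_const, filter_filter, filter_filter]

/-! ### Steps of arc diagrams -/

theorem exists_hasStep (k : Fin n) : ∃ t, HasStep Fin.val π k t := by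
  by_cases hk : π k = k
  · exact ⟨.E, .inl hk⟩
  have h₁ : (π k).val ≠ k := fun h => hk (Fin.ext h)
  have h₂ : (π.symm k).val ≠ k := fun h => hk ((Equiv.symm_apply_eq _).1 (Fin.ext h)).symm
  rcases lt_or_gt_of_ne h₁ with h₁ | h₁ <;> rcases lt_or_gt_of_ne h₂ with h₂ | h₂
  exacts [⟨.S, h₁, h₂⟩, ⟨.F, h₁, h₂⟩, ⟨.E, .inr ⟨h₂, h₁⟩⟩, ⟨.N, h₁, h₂⟩]

/-- The closing arc falls from the last letter to the cycle minimum, so its absence can only turn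
`⇌` into `→` at a valley or peak, or the left shape `←` into `∅` at a double fall. The table gives
the same step in both cases. -/
theorem theta_eq_of_hasStep {k : Fin n} {t : Step} (h : HasStep Fin.val π k t) :
    theta π k = some t := by
  have e₁ : (∃ a, a < k ∧ (a, k) ∈ arcs π) ↔ π.symm k < k := by
    simp only [mem_arcs]
    constructor
    · rintro ⟨a, ha, rfl, -⟩
      simpa using ha
    · exact fun h => ⟨_, h, by simp, fun hm => (hm _ ⟨-1, by simp⟩).not_gt h⟩
  have e₂ : (∃ a, a < k ∧ (k, a) ∈ arcs π) ↔ π k < k ∧ ¬ IsCycleMin π (π k) := by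
    simp [mem_arcs]
  have e₃ : (∃ a, k < a ∧ (k, a) ∈ arcs π) ↔ k < π k := by
    simpa [mem_arcs] using not_isCycleMin_apply
  have e₄ : (∃ a, k < a ∧ (a, k) ∈ arcs π) ↔ k < π.symm k ∧ ¬ IsCycleMin π k := by
    simp only [mem_arcs]
    constructor
    · rintro ⟨a, ha, rfl, hm⟩
      simpa using ⟨ha, hm⟩
    · exact fun h => ⟨_, h.1, by simp, h.2⟩
  rw [theta, leftShape, rightShape, e₁, e₂, e₃, e₄]
  cases t <;> simp only [HasStep, Fin.val_fin_lt] at h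
  · by_cases hm : IsCycleMin π k <;> simp [h.1, h.2, h.1.not_gt, h.2.not_gt, hm, Shape.mk, stepOfShapes]
  · by_cases hm : IsCycleMin π (π k) <;>
      simp [h.1, h.2, h.1.not_gt, h.2.not_gt, hm, Shape.mk, stepOfShapes]
  · rcases h with h | h
    · have h' : π.symm k = k := by rw [Equiv.symm_apply_eq, h]
      simp [h, h', Shape.mk, stepOfShapes]
    · simp [h.1, h.2, h.1.not_gt, h.2.not_gt, Shape.mk, stepOfShapes]
  · have hk : ¬ IsCycleMin π k := fun hm => (hm _ ⟨1, by simp⟩).not_gt h.1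
    by_cases hm : IsCycleMin π (π k) <;>
      simp [h.1, h.2, h.1.not_gt, h.2.not_gt, hm, hk, Shape.mk, stepOfShapes]

theorem theta_eq_iff {s : Fin n → Step} :
    (∀ k, theta π k = some (s k)) ↔ InClass Fin.val s π := by
  refine forall_congr' fun k => ⟨fun h => ?_, theta_eq_of_hasStep⟩
  obtain ⟨t, ht⟩ := exists_hasStep (π := π) k
  rw [theta_eq_of_hasStep ht, Option.some.injEq] at h
  exact h ▸ ht

variable (π)

theorem exists_inClass : ∃ s, InClass Fin.val s π := by
  choose s hs using exists_hasStep (π := π)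
  exact ⟨s, hs⟩

variable {π}

theorem InClass.word_unique {s t : Fin n → Step} (hs : InClass Fin.val s π)
    (ht : InClass Fin.val t π) : s = t := by
  funext k
  have := theta_eq_iff.2 hs k
  rw [theta_eq_iff.2 ht k] at this
  exact (Option.some.inj this).symm

/-! ### Classes of permutations and their paths -/

variable {R : Type*} [CommRing R] (p q x : R)

open Classical in
theorem sum_permWeight_inClass (s : Fin n → Step) :
    ∑ π with InClass Fin.val s π, permWeight p q x π = pathWeight p q x n 0 s := by
  rw [← wordWeight_fin, wordWeight, sum_filter]
  simp only [classTerm, permWeight_eq]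

theorem sum_permWeight : ∑ π : Perm (Fin n), permWeight p q x π = pathSum p q x n 0 := by
  classical
  simp only [pathSum, ← sum_permWeight_inClass, sum_filter]
  rw [sum_comm]
  refine sum_congr rfl fun π _ => ?_
  obtain ⟨s, hs⟩ := exists_inClass π
  rw [Finset.sum_eq_single s, if_pos hs]
  · exact fun t _ hts => if_neg fun ht => hts (ht.word_unique hs)
  · simp

/-- Turns the weight identity into an existence statement: a class is nonempty if and only if this
integer is nonzero. -/
theorem pathWeight_one_eq_card (s : Fin n → Step) [DecidablePred (InClass (α := Fin n) Fin.val s)] :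
    pathWeight (1 : ℤ) 1 1 n 0 s = #{π | InClass Fin.val s π} := by
  classical
  rw [← sum_permWeight_inClass]
  simp only [permWeight, one_pow, mul_one, sum_const, nsmul_eq_mul]
  congr!

theorem InClass.isPathFrom {s : Fin n → Step} (h : InClass Fin.val s π) : IsPathFrom 0 s := by
  classical
  refine isPathFrom_of_pathWeight_ne_zero (1 : ℤ) 1 1 (h := 0) ?_
  rw [pathWeight_one_eq_card, Nat.cast_ne_zero, card_ne_zero]
  exact ⟨π, by simpa using h⟩

theorem IsPathFrom.exists_inClass {s : Fin n → Step} (h : IsPathFrom 0 s) :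
    ∃ π, InClass Fin.val s π := by
  classical
  have := pathWeight_pos (h := 0) h
  rw [pathWeight_one_eq_card, Nat.cast_pos, card_pos] at this
  obtain ⟨π, hπ⟩ := this
  exact ⟨π, by simpa using hπ⟩

variable (π)

/-- The Motzkin path that is read off the arc diagram of `π`. -/
noncomputable def motzkinPath : {γ : MotzkinPath n // γ.NoFAtZero} :=
  have h := (exists_inClass π).choose_spec.isPathFrom
  ⟨⟨(exists_inClass π).choose, fun k hk => by simpa using h.1 k hk, by simpa using h.2.1⟩,
    fun k hk => by simpa using h.2.2 k hk⟩

theorem inClass_motzkinPath : InClass Fin.val (motzkinPath π).1.step π :=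
  (exists_inClass π).choose_spec

variable {π}

theorem motzkinPath_eq_iff {γ : {γ : MotzkinPath n // γ.NoFAtZero}} :
    motzkinPath π = γ ↔ InClass Fin.val γ.1.step π := by
  refine ⟨fun h => h ▸ inClass_motzkinPath π, fun h => ?_⟩
  obtain ⟨⟨s, _, _⟩, _⟩ := γ
  have := (inClass_motzkinPath π).word_unique h
  rw [Subtype.ext_iff]
  generalize (motzkinPath π).1 = δ at this
  obtain ⟨t, _, _⟩ := δ
  subst this
  rfl

theorem theta_eq_theta_iff {σ : Perm (Fin n)} :
    theta π = theta σ ↔ motzkinPath π = motzkinPath σ := by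
  rw [motzkinPath_eq_iff, ← theta_eq_iff, funext_iff]
  simp only [theta_eq_iff.2 (inClass_motzkinPath σ)]

theorem motzkinPath_surjective : Function.Surjective (motzkinPath (n := n)) := by
  rintro ⟨γ, hγ⟩
  obtain ⟨π, hπ⟩ := IsPathFrom.exists_inClass (s := γ.step)
    ⟨by simpa using γ.height_nonneg, by simpa using γ.height_end, fun k hk => by simpa using hγ k hk⟩
  exact ⟨π, motzkinPath_eq_iff.2 hπ⟩

/-- Classes of permutations correspond to Motzkin paths. -/
noncomputable def classEquiv (n : ℕ) :
    Quotient (thetaSetoid n) ≃ {γ : MotzkinPath n // γ.NoFAtZero} :=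
  Equiv.ofBijective (Quotient.lift motzkinPath fun _ _ h => theta_eq_theta_iff.1 h)
    ⟨by
      rintro ⟨π⟩ ⟨σ⟩ h
      exact Quotient.sound (theta_eq_theta_iff.2 h), fun γ => by
      obtain ⟨π, rfl⟩ := motzkinPath_surjective γ
      exact ⟨Quotient.mk _ π, rfl⟩⟩

theorem classEquiv_mk (π : Perm (Fin n)) :
    classEquiv n (Quotient.mk (thetaSetoid n) π) = motzkinPath π := rfl

theorem classWeight_eq (C : Quotient (thetaSetoid n)) :
    classWeight p q x C = (classEquiv n C).1.weight p q x := by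
  classical
  have hC : ∀ π, Quotient.mk (thetaSetoid n) π = C ↔
      InClass Fin.val (classEquiv n C).1.step π := fun π => by
    rw [← (classEquiv n).apply_eq_iff_eq, classEquiv_mk, motzkinPath_eq_iff]
  have hp : IsPathFrom ((0 : ℕ) : ℤ) (classEquiv n C).1.step := by
    obtain ⟨π, hπ⟩ := Quotient.exists_rep C
    exact ((hC π).1 hπ).isPathFrom
  rw [classWeight, MotzkinPath.weight]
  simp only [hC]
  rw [sum_permWeight_inClass, pathWeight_eq_prod p q x hp]
  simp

end CycleForm

end CyclePatterns

theorem mainTheorem1 {R : Type*} [CommRing R] (p q x : R) :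
    CyclePatterns.HasJFraction (CyclePatterns.genFun p q x)
      (fun h : ℕ => (h : R) * q + (h : R) * p + x)
      (fun h : ℕ => (h : R) * q * (((h : R) - 1) * p + x)) ∧
    ∀ n : ℕ, ∃ Φ : Quotient (CyclePatterns.thetaSetoid n) ≃
        {γ : CyclePatterns.MotzkinPath n // γ.NoFAtZero},
      (∀ (π : Equiv.Perm (Fin n)) (k : Fin n),
        CyclePatterns.theta π k =
          some ((Φ (Quotient.mk (CyclePatterns.thetaSetoid n) π)).1.step k)) ∧
      ∀ C : Quotient (CyclePatterns.thetaSetoid n),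
        CyclePatterns.classWeight p q x C = (Φ C).1.weight p q x := by
  refine ⟨?_, fun n => ⟨CyclePatterns.classEquiv n, fun π => ?_,
    CyclePatterns.classWeight_eq p q x⟩⟩
  · simp only [CyclePatterns.genFun, CyclePatterns.sum_permWeight]
    exact CyclePatterns.hasJFraction_pathSum p q x
  · exact CyclePatterns.theta_eq_iff.2 (CyclePatterns.inClass_motzkinPath π)
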